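/- Let $\mathbb K\subset\mathbb C$ be a field, let $\mathbf f=(f_1,\dots,f_N)$ with $f_k\in\mathbb K[x_1,\dots,x_n]$, and let $\xi\in\mathbb C^n$ be an isolated root of $\mathbf f$, i.e. a root that is the only root of $\mathbf f$ in some Zariski open neighbourhood of $\xi$. **Multiplicity and nil-index.** Let $\mathbf g$ be a finite system in $\mathbb K[x_1,\dots,x_n]$ with isolated root $\xi$, and let $I$ be the ideal of $\mathbb C[x_1,\dots,x_n]$ that it generates. The multiplicity is $\delta_\xi(\mathbf g)=\dim_{\mathbb C}\mathbb C[x_1,\dots,x_n]/Q$, where $Q$ is the primary component of $I$ at $\xi$. Let an element $\Lambda=\sum_\beta a_\beta\partial^\beta$ of $\mathbb C[\partial_1,\dots,\partial_n]$ act on polynomials by $\Lambda(p)=\sum_\beta a_\beta\,(\partial^\beta p)(\xi)$; its order is its total degree in $\partial_1,\dots,\partial_n$. Let $\mathscr D=\{\Lambda : \Lambda(p)=0\text{ for all }p\in I\}$ and let $\mathscr D_t$ be the set of elements of $\mathscr D$ of order at most $t$. The nil-index $o_\xi(\mathbf g)$ is the smallest $t\ge 0$ with $\mathscr D_{t+1}=\mathscr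 D_t$. **Deflated system.** Let $J_{\mathbf f}=[\partial_j f_k]$ be the Jacobian matrix, let $r=\operatorname{rank}J_{\mathbf f}(\xi)$, assume $r<n$, and put $c=n-r$. Reorder the rows and columns of $J_{\mathbf f}$ in any way such that $$J_{\mathbf f}=\begin{pmatrix}A&B\\ C&D\end{pmatrix}$$ with $A$ of size $r\times r$ and $\operatorname{rank}A(\xi)=r$. The $c$ columns of the polynomial matrix $$\det(A)\begin{pmatrix}-A^{-1}B\\ \mathrm{Id}\end{pmatrix}$$ (the identity matrix if $r=0$) are the coefficient vectors of differential operators $\Lambda_i=\sum_{j=1}^n\lambda_{i,j}(\mathbf x)\,\partial_j$, $i=1,\dots,c$. For a nonempty set $\mathbf i\subset\{1,\dots,c\}$, the $\mathbf i$-deflated system $\mathbf f^{(1)}$ of order $1$ consists of $f_1,\dots,f_N$ together with all $\Lambda_i(f_k)$, $i\in\mathbf i$, $1\le k\le N$. **Claim.** The point $\xi$ is still an isolated root of $\mathbf f^{(1)}$, and $$\delta_\xi(\mathbf f^{(1)})\ge 1,\qquad o_\xi(\mathbf f^{(1)})<o_\xi(\mathbf f),\qquad \delta_\xi(\mathbf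 f^{(1)})<\delta_\xi(\mathbf f).$$ -/

import Mathlib

open MvPolynomial

noncomputable section

namespace Deflation

/-! ### Roots, ideals and multiplicity of a polynomial system

A system is a family `f : ι → K[x₁, …, xₙ]`; `K` is a subfield of `ℂ`. -/

variable {K : Type*} [Field K] [Algebra K ℂ] {ι : Type*} {n : ℕ}

/-- `ξ` is a common zero of the system `f`. -/
def IsRoot (f : ι → MvPolynomial (Fin n) K) (ξ : Fin n → ℂ) : Prop :=
  ∀ k, aeval ξ (f k) = 0

/-- `ξ` is an isolated root of `f`: it is a root, and it is the only root of `f` in some Zariski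
open neighbourhood `{x | g x ≠ 0}` of `ξ`. -/
def IsIsolatedRoot (f : ι → MvPolynomial (Fin n) K) (ξ : Fin n → ℂ) : Prop :=
  IsRoot f ξ ∧ ∃ g : MvPolynomial (Fin n) ℂ, eval ξ g ≠ 0 ∧
    ∀ x : Fin n → ℂ, IsRoot f x → eval x g ≠ 0 → x = ξ

/-- The ideal of `ℂ[x₁, …, xₙ]` generated by the system `f`. -/
def systemIdeal (f : ι → MvPolynomial (Fin n) K) : Ideal (MvPolynomial (Fin n) ℂ) :=
  Ideal.span (Set.range fun k => MvPolynomial.map (algebraMap K ℂ) (f k))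

/-- The contraction to `ℂ[x]` of the extension of `I` to the local ring at `ξ`, that is, the set of
`p` with `g p ∈ I` for some `g` not vanishing at `ξ`. At an isolated zero `ξ` of `I` this is the
primary component of `I` at `ξ`. -/
def primaryComponent (I : Ideal (MvPolynomial (Fin n) ℂ)) (ξ : Fin n → ℂ) :
    Ideal (MvPolynomial (Fin n) ℂ) where
  carrier := {p | ∃ g, eval ξ g ≠ 0 ∧ g * p ∈ I}
  zero_mem' := ⟨1, by simp, by simp⟩
  add_mem' := by
    rintro p q ⟨g, hg, hp⟩ ⟨h, hh, hq⟩
    refine ⟨g * h, by simp [hg, hh], ?_⟩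
    have e : g * h * (p + q) = h * (g * p) + g * (h * q) := by ring
    rw [e]
    exact I.add_mem (I.mul_mem_left _ hp) (I.mul_mem_left _ hq)
  smul_mem' := by
    rintro c p ⟨g, hg, hp⟩
    refine ⟨g, hg, ?_⟩
    have e : g * (c • p) = c * (g * p) := by rw [smul_eq_mul]; ring
    rw [e]
    exact I.mul_mem_left _ hp

/-- The multiplicity `δ_ξ(f) = dim_ℂ ℂ[x] / Q`, with `Q` the primary component at `ξ` of the ideal
generated by `f`. -/
def multiplicity (f : ι → MvPolynomial (Fin n) K) (ξ : Fin n → ℂ) : ℕ :=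
  Module.finrank ℂ (MvPolynomial (Fin n) ℂ ⧸ primaryComponent (systemIdeal f) ξ)

/-! ### The inverse system and its nil-index -/

/-- The iterated partial derivative `∂^β = ∂₁^β₁ ⋯ ∂ₙ^βₙ`. -/
def iterPderiv (β : Fin n →₀ ℕ) : Module.End ℂ (MvPolynomial (Fin n) ℂ) :=
  (List.ofFn fun j : Fin n =>
    ((pderiv j).toLinearMap : Module.End ℂ (MvPolynomial (Fin n) ℂ)) ^ β j).prod

/-- An element `Λ = ∑ a_β ∂^β` of `ℂ[∂₁, …, ∂ₙ]`, seen as the functional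
`p ↦ ∑ a_β (∂^β p)(ξ)` on `ℂ[x₁, …, xₙ]`. The variables of the first polynomial ring are the
symbols `∂₁, …, ∂ₙ`. -/
def diffEval (ξ : Fin n → ℂ) :
    MvPolynomial (Fin n) ℂ →ₗ[ℂ] Module.Dual ℂ (MvPolynomial (Fin n) ℂ) :=
  (basisMonomials (Fin n) ℂ).constr ℂ fun β =>
    (aeval ξ : MvPolynomial (Fin n) ℂ →ₐ[ℂ] ℂ).toLinearMap ∘ₗ iterPderiv β

/-- The inverse system `𝒟 = I^⊥ ∩ ℂ[∂_ξ]` of `f` at `ξ`, where `I` is the ideal generated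
by `f`. -/
def inverseSystem (f : ι → MvPolynomial (Fin n) K) (ξ : Fin n → ℂ) :
    Submodule ℂ (MvPolynomial (Fin n) ℂ) :=
  ((systemIdeal f).restrictScalars ℂ).dualAnnihilator.comap (diffEval ξ)

/-- `𝒟_t`: the elements of the inverse system of order (total degree in the `∂_j`) at most `t`. -/
def inverseSystemLE (f : ι → MvPolynomial (Fin n) K) (ξ : Fin n → ℂ) (t : ℕ) :
    Submodule ℂ (MvPolynomial (Fin n) ℂ) :=
  inverseSystem f ξ ⊓ restrictTotalDegree (Fin n) ℂ t

/-- The nil-index `o_ξ(f)`: the smallest `t` with `𝒟_{t+1} = 𝒟_t`. -/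
def nilIndex (f : ι → MvPolynomial (Fin n) K) (ξ : Fin n → ℂ) : ℕ :=
  sInf {t | inverseSystemLE f ξ (t + 1) = inverseSystemLE f ξ t}

/-! ### The deflated system of order one -/

/-- The Jacobian matrix `[∂_j f_k]`, with polynomial entries. -/
def jacobian (f : ι → MvPolynomial (Fin n) K) : Matrix ι (Fin n) (MvPolynomial (Fin n) K) :=
  Matrix.of fun k j => pderiv j (f k)

/-- The value at the point `ξ` of a matrix of polynomials. -/
def evalMatrix {l m : Type*} (ξ : Fin n → ℂ) (M : Matrix l m (MvPolynomial (Fin n) K)) :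
    Matrix l m ℂ :=
  M.map (aeval ξ)

variable {r s c : ℕ}

/-- The upper left block `A` of the Jacobian matrix after the rows and columns are reordered by
`rows` and `cols`. -/
def blockA (f : ι → MvPolynomial (Fin n) K) (rows : Fin r ⊕ Fin s ≃ ι)
    (cols : Fin r ⊕ Fin c ≃ Fin n) : Matrix (Fin r) (Fin r) (MvPolynomial (Fin n) K) :=
  ((jacobian f).submatrix rows cols).toBlocks₁₁

/-- The upper right block `B` of the reordered Jacobian matrix. -/
def blockB (f : ι → MvPolynomial (Fin n) K) (rows : Fin r ⊕ Fin s ≃ ι)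
    (cols : Fin r ⊕ Fin c ≃ Fin n) : Matrix (Fin r) (Fin c) (MvPolynomial (Fin n) K) :=
  ((jacobian f).submatrix rows cols).toBlocks₁₂

/-- The matrix `det A • [-A⁻¹ B; Id]`, whose entries are polynomials because
`det A • A⁻¹` is the adjugate of `A`. -/
def kernelMatrix (f : ι → MvPolynomial (Fin n) K) (rows : Fin r ⊕ Fin s ≃ ι)
    (cols : Fin r ⊕ Fin c ≃ Fin n) :
    Matrix (Fin r ⊕ Fin c) (Fin c) (MvPolynomial (Fin n) K) :=
  Matrix.fromRows (-((blockA f rows cols).adjugate * blockB f rows cols))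
    ((blockA f rows cols).det • (1 : Matrix (Fin c) (Fin c) (MvPolynomial (Fin n) K)))

/-- The differential `Λ_i = ∑ⱼ λ_{i,j}(x) ∂_j` whose coefficients form the `i`-th column of
`kernelMatrix`, applied to the polynomial `p`. -/
def formalDifferential (f : ι → MvPolynomial (Fin n) K) (rows : Fin r ⊕ Fin s ≃ ι)
    (cols : Fin r ⊕ Fin c ≃ Fin n) (i : Fin c) (p : MvPolynomial (Fin n) K) :
    MvPolynomial (Fin n) K :=
  ∑ j : Fin n, kernelMatrix f rows cols (cols.symm j) i * pderiv j p

/-- The `S`-deflated system of order one of `f`: the polynomials `f_k` together with the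
`Λ_i(f_k)` for `i ∈ S`. -/
def deflatedSystem (f : ι → MvPolynomial (Fin n) K) (rows : Fin r ⊕ Fin s ≃ ι)
    (cols : Fin r ⊕ Fin c ≃ Fin n) (S : Finset (Fin c)) :
    ι ⊕ (S × ι) → MvPolynomial (Fin n) K :=
  Sum.elim f fun q => formalDifferential f rows cols q.1 (f q.2)

end Deflation

end

/-!
Write `𝔪` for the maximal ideal of `ξ` and `Q_f` for the primary component of `f` at `ξ`. Taylor
expansion at `ξ` identifies `𝒟_t` with the annihilator of `I_f + 𝔪 ^ (t + 1)`, so `𝒟_{t+1} = 𝒟_t`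
means `𝔪 ^ (t + 1) ⊆ I_f + 𝔪 ^ (t + 2)`; since some power of `𝔪` lies in `Q_f`, Nakayama's argument
turns this into `𝔪 ^ (t + 1) ⊆ Q_f`, and the nil-index is the least such `t`.

The operator `Λ_i` maps `I_f` into the ideal of the deflated system `f⁽¹⁾`, hence `Q_f` into
`Q_{f⁽¹⁾}`, and it is transversal at `ξ`: if `l` is the `i`-th coordinate of the second block,
centred at `ξ`, then `Λ_i l` takes the value `det A(ξ) ≠ 0` at `ξ`. The Leibniz rule for
`l ^ (j + 1) * q` therefore trades a power of `l` for a derivative of `q`, which shows that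
`𝔪 ^ (t + 1) ⊆ Q_f` implies `𝔪 ^ t ⊆ Q_{f⁽¹⁾}`. So the nil-index drops; in particular
`Q_f ≠ Q_{f⁽¹⁾}`, and the multiplicity drops as well.
-/

namespace Deflation

section Derivations

variable {R A : Type*} [CommRing R] [CommRing A] [Algebra R A]

lemma derivation_mem_pow_pred (D : Derivation R A A) {I : Ideal A} {m : ℕ} {a : A}
    (ha : a ∈ I ^ m) : D a ∈ I ^ (m - 1) := by
  induction m generalizing a with
  | zero => simp
  | succ m ih =>
    rw [pow_succ'] at ha
    refine Submodule.mul_induction_on ha (fun b hb c hc => ?_) fun b c hb hc => ?_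
    · rw [D.leibniz, smul_eq_mul, smul_eq_mul, Nat.add_sub_cancel]
      refine add_mem ?_ (Ideal.mul_mem_right _ _ hc)
      cases m with
      | zero => simp
      | succ m =>
        rw [pow_succ']
        exact Ideal.mul_mem_mul hb (ih hc)
    · rw [map_add]
      exact add_mem hb hc

lemma derivation_mem_of_span (D : Derivation R A A) {s : Set A} {J : Ideal A}
    (hs : Ideal.span s ≤ J) (hD : ∀ a ∈ s, D a ∈ J) {a : A} (ha : a ∈ Ideal.span s) :
    D a ∈ J := by
  refine Submodule.span_induction hD (by simp) (fun b c _ _ hb hc => ?_)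
    (fun b c hc h => ?_) ha
  · rw [map_add]
    exact add_mem hb hc
  · rw [smul_eq_mul, D.leibniz, smul_eq_mul, smul_eq_mul]
    exact add_mem (J.mul_mem_left _ h) (J.mul_mem_right _ (hs hc))

end Derivations

section Transversal

variable {k A : Type*} [Field k] [CharZero k] [CommRing A] [Algebra k A]
  {D : Derivation k A A} {l : A} {𝔪 Q Q' : Ideal A}

lemma pow_mul_mem_of_derivation (hD : ∀ p ∈ Q, D p ∈ Q') (hl : ∀ p, D l * p ∈ Q' → p ∈ Q')
    {j : ℕ} {q : A} (hq : l ^ (j + 1) * q ∈ Q) (hDq : l ^ (j + 1) * D q ∈ Q') :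
    l ^ j * q ∈ Q' := by
  have hleibniz : D (l ^ (j + 1) * q) =
      algebraMap k A (j + 1) * (D l * (l ^ j * q)) + l ^ (j + 1) * D q := by
    simp only [D.leibniz, D.leibniz_pow, smul_eq_mul, nsmul_eq_mul, Nat.add_sub_cancel, map_add,
      map_natCast, map_one, Nat.cast_succ]
    ring
  have hunit : IsUnit (algebraMap k A (j + 1)) :=
    (Nat.cast_add_one_ne_zero j).isUnit.map (algebraMap k A)
  refine hl _ ((Ideal.unit_mul_mem_iff_mem _ hunit).1 ?_)
  rw [← Ideal.add_mem_iff_left _ hDq, ← hleibniz]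
  exact hD _ hq

lemma pow_le_of_derivation (hQ : Q ≤ Q') (hD : ∀ p ∈ Q, D p ∈ Q')
    (hl : ∀ p, D l * p ∈ Q' → p ∈ Q') (hl𝔪 : l ∈ 𝔪) {t : ℕ} (ht : 𝔪 ^ (t + 1) ≤ Q) :
    𝔪 ^ t ≤ Q' := by
  have key : ∀ m j, j + m = t + 1 → ∀ q ∈ 𝔪 ^ (m - 1), l ^ j * q ∈ Q' := by
    intro m
    induction m with
    | zero =>
      rintro j rfl q -
      exact hQ (Q.mul_mem_right _ (ht (Ideal.pow_mem_pow hl𝔪 _)))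
    | succ m ih =>
      intro j hj q hq
      refine pow_mul_mem_of_derivation hD hl (ht ?_)
        (ih (j + 1) (by omega) _ (derivation_mem_pow_pred D hq))
      rw [← hj, show j + (m + 1) = (j + 1) + m by ring, pow_add]
      exact Ideal.mul_mem_mul (Ideal.pow_mem_pow hl𝔪 _) hq
  intro q hq
  simpa using key (t + 1) 0 (zero_add _) q hq

end Transversal

section Quotients

lemma le_of_le_sup_mul_of_pow_le {A : Type*} [CommRing A] {I N Q : Ideal A} {M : ℕ}
    (hM : I ^ M ≤ Q) (hN : N ≤ Q ⊔ I * N) : N ≤ Q := by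
  have hpow : ∀ k, N ≤ Q ⊔ I ^ k * N := by
    intro k
    induction k with
    | zero => simp
    | succ k ih =>
      calc N ≤ Q ⊔ I ^ k * N := ih
        _ ≤ Q ⊔ I ^ k * (Q ⊔ I * N) := sup_le_sup_left (Ideal.mul_mono_right hN) _
        _ = Q ⊔ I ^ k * Q ⊔ I ^ (k + 1) * N := by rw [Ideal.mul_sup, sup_assoc, pow_succ, mul_assoc]
        _ ≤ Q ⊔ I ^ (k + 1) * N := sup_le_sup_right (sup_le le_rfl Ideal.mul_le_right) _
  exact (hpow M).trans (sup_le le_rfl (Ideal.mul_le_left.trans hM))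

lemma finite_quotient_of_pow_le {R A : Type*} [CommRing R] [CommRing A] [Algebra R A]
    {I Q : Ideal A} [Module.Finite R (A ⧸ I)] (hI : I.FG) {M : ℕ} (hM : I ^ M ≤ Q) :
    Module.Finite R (A ⧸ Q) := by
  have : Module.Finite R (A ⧸ I ⊔ Q) :=
    .of_surjective (Ideal.Quotient.factorₐ R le_sup_left).toLinearMap
      (Ideal.Quotient.factor_surjective le_sup_left)
  have hker : RingHom.ker (Ideal.Quotient.factorₐ R (le_sup_right : Q ≤ I ⊔ Q)) =
      I.map (Ideal.Quotient.mk Q) := by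
    refine (Ideal.Quotient.factor_ker le_sup_right).trans ?_
    rw [Ideal.map_sup, Ideal.map_quotient_self, sup_bot_eq]
  have hnil : IsNilpotent (I.map (Ideal.Quotient.mk Q)) := by
    refine ⟨M, ?_⟩
    rwa [← Ideal.map_pow, Ideal.zero_eq_bot, Ideal.map_eq_bot_iff_le_ker, Ideal.mk_ker]
  refine Module.finite_of_surjective_of_ker_le_nilradical
    (Ideal.Quotient.factorₐ R (le_sup_right : Q ≤ I ⊔ Q))
    (Ideal.Quotient.factor_surjective le_sup_right) ?_ ?_ <;> rw [hker]
  · exact (hI.map _).isNilpotent_iff_le_nilradical.1 hnil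
  · exact hI.map _

lemma finrank_quotient_lt {k A : Type*} [Field k] [CommRing A] [Algebra k A] {P Q : Ideal A}
    [Module.Finite k (A ⧸ P)] (h : P < Q) :
    Module.finrank k (A ⧸ Q) < Module.finrank k (A ⧸ P) := by
  let φ := (Ideal.Quotient.factorₐ k h.le).toLinearMap
  have hφ : Function.Surjective φ := Ideal.Quotient.factor_surjective h.le
  refine (LinearMap.finrank_le_finrank_of_surjective hφ).lt_of_ne fun heq => ?_
  have : Module.Finite k (A ⧸ Q) := .of_surjective φ hφ
  have hinj := (LinearMap.injective_iff_surjective_of_finrank_eq_finrank heq.symm).2 hφ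
  refine h.not_ge fun a ha => ?_
  rw [← Ideal.Quotient.eq_zero_iff_mem] at ha ⊢
  exact hinj (ha.trans (map_zero φ).symm)

end Quotients

section PrimaryComponent

variable {n : ℕ} {ξ : Fin n → ℂ} {I J : Ideal (MvPolynomial (Fin n) ℂ)}

lemma le_primaryComponent (I : Ideal (MvPolynomial (Fin n) ℂ)) (ξ : Fin n → ℂ) :
    I ≤ primaryComponent I ξ :=
  fun p hp => ⟨1, by simp, by simpa using hp⟩

lemma primaryComponent_mono (h : I ≤ J) : primaryComponent I ξ ≤ primaryComponent J ξ :=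
  fun _ ⟨g, hg, hp⟩ => ⟨g, hg, h hp⟩

lemma mem_primaryComponent_of_mul_mem {g p : MvPolynomial (Fin n) ℂ} (hg : eval ξ g ≠ 0)
    (h : g * p ∈ primaryComponent I ξ) : p ∈ primaryComponent I ξ := by
  obtain ⟨g', hg', hp⟩ := h
  exact ⟨g' * g, by simp [hg, hg'], by rwa [mul_assoc]⟩

lemma primaryComponent_ne_top (h : I ≤ vanishingIdeal ℂ {ξ}) : primaryComponent I ξ ≠ ⊤ := by
  rw [Ideal.ne_top_iff_one]
  rintro ⟨g, hg, hgI⟩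
  rw [mul_one] at hgI
  exact hg (by simpa [aeval_eq_eval] using mem_vanishingIdeal_singleton_iff ξ g |>.1 (h hgI))

lemma primaryComponent_le_sup_pow (I : Ideal (MvPolynomial (Fin n) ℂ)) (ξ : Fin n → ℂ) (m : ℕ) :
    primaryComponent I ξ ≤ I ⊔ vanishingIdeal ℂ {ξ} ^ m := by
  rintro p ⟨g, hg, hgp⟩
  have hg𝔪 : g ∉ vanishingIdeal ℂ {ξ} := by
    rwa [mem_vanishingIdeal_singleton_iff, aeval_eq_eval]
  obtain ⟨y, z, hz, hyz⟩ := Ideal.IsMaximal.exists_inv_pow _ hg𝔪 m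
  rw [← one_mul p, ← hyz, add_mul, mul_assoc]
  exact Submodule.add_mem_sup (I.mul_mem_left _ hgp) (Ideal.mul_mem_right _ _ hz)

lemma derivation_mem_primaryComponent
    (D : Derivation ℂ (MvPolynomial (Fin n) ℂ) (MvPolynomial (Fin n) ℂ)) (hIJ : I ≤ J)
    (hD : ∀ p ∈ I, D p ∈ J) {p : MvPolynomial (Fin n) ℂ} (hp : p ∈ primaryComponent I ξ) :
    D p ∈ primaryComponent J ξ := by
  have hpJ := primaryComponent_mono hIJ hp
  obtain ⟨g, hg, hgp⟩ := hp
  refine mem_primaryComponent_of_mul_mem hg ?_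
  have h := le_primaryComponent J ξ (hD _ hgp)
  rw [D.leibniz, smul_eq_mul, smul_eq_mul] at h
  exact (Ideal.add_mem_iff_left _ (Ideal.mul_mem_right _ _ hpJ)).1 h

end PrimaryComponent

section Systems

variable {K : Type*} [Field K] [Algebra K ℂ] {ι κ : Type*} {n : ℕ}
  {f : ι → MvPolynomial (Fin n) K} {g : κ → MvPolynomial (Fin n) K} {ξ : Fin n → ℂ}

lemma systemIdeal_le_vanishingIdeal_iff : systemIdeal f ≤ vanishingIdeal ℂ {ξ} ↔ IsRoot f ξ := by
  rw [systemIdeal, Ideal.span_le, Set.range_subset_iff]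
  simp only [SetLike.mem_coe, mem_vanishingIdeal_singleton_iff, aeval_map_algebraMap, IsRoot]

lemma IsIsolatedRoot.exists_pow_le (hf : IsIsolatedRoot f ξ) :
    ∃ M, vanishingIdeal ℂ {ξ} ^ M ≤ primaryComponent (systemIdeal f) ξ := by
  obtain ⟨-, g, hg, hiso⟩ := hf
  refine Ideal.exists_pow_le_of_le_radical_of_fg (fun p hp => ?_) (IsNoetherian.noetherian _)
  have hrad : g * p ∈ (systemIdeal f).radical := by
    rw [← vanishingIdeal_zeroLocus_eq_radical (K := ℂ), mem_vanishingIdeal_iff]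
    intro x hx
    have hroot : IsRoot f x := by
      rw [← systemIdeal_le_vanishingIdeal_iff, ← le_zeroLocus_iff_le_vanishingIdeal]
      simpa using hx
    rw [map_mul, mul_eq_zero, or_iff_not_imp_left]
    intro hgx
    obtain rfl := hiso x hroot hgx
    exact (mem_vanishingIdeal_singleton_iff _ _).1 hp
  obtain ⟨m, hm⟩ := hrad
  exact ⟨m, g ^ m, by simp [hg], by rwa [← mul_pow]⟩

lemma IsIsolatedRoot.of_systemIdeal_le (hf : IsIsolatedRoot f ξ) (hg : IsRoot g ξ)
    (hfg : systemIdeal f ≤ systemIdeal g) : IsIsolatedRoot g ξ := by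
  obtain ⟨-, h, hh, hiso⟩ := hf
  refine ⟨hg, h, hh, fun x hx => hiso x ?_⟩
  rw [← systemIdeal_le_vanishingIdeal_iff] at hx ⊢
  exact hfg.trans hx

lemma IsIsolatedRoot.finite_quotient (hf : IsIsolatedRoot f ξ) :
    Module.Finite ℂ (MvPolynomial (Fin n) ℂ ⧸ primaryComponent (systemIdeal f) ξ) := by
  obtain ⟨M, hM⟩ := hf.exists_pow_le
  let := Ideal.Quotient.field (vanishingIdeal ℂ {ξ})
  have : Module.Finite ℂ (MvPolynomial (Fin n) ℂ ⧸ vanishingIdeal ℂ {ξ}) :=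
    finite_of_finite_type_of_isJacobsonRing _ _
  exact finite_quotient_of_pow_le (IsNoetherian.noetherian _) hM

lemma IsIsolatedRoot.one_le_multiplicity (hf : IsIsolatedRoot f ξ) : 1 ≤ multiplicity f ξ := by
  have := hf.finite_quotient
  have := Ideal.Quotient.nontrivial_iff.2
    (primaryComponent_ne_top (systemIdeal_le_vanishingIdeal_iff.2 hf.1))
  exact Module.finrank_pos

end Systems

section Translation

variable {σ R k : Type*} [CommRing R] [Field k]

/-- The automorphism `X i ↦ X i - a i` of the polynomial ring, which moves the origin to the
point `a`. It reduces statements at `a` to statements on coefficients. -/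
noncomputable def translate (a : σ → R) : MvPolynomial σ R ≃ₐ[R] MvPolynomial σ R :=
  AlgEquiv.ofAlgHom (aeval fun i => X i - C (a i)) (aeval fun i => X i + C (a i))
    (by ext i; simp [algHom_C, ← algebraMap_eq]) (by ext i; simp [algHom_C, ← algebraMap_eq])

lemma translate_X (a : σ → R) (i : σ) : translate a (X i) = X i - C (a i) :=
  aeval_X _ i

lemma eval_translate (a : σ → R) (p : MvPolynomial σ R) :
    eval a (translate a p) = constantCoeff p := by
  suffices (aeval a).comp (translate a).toAlgHom = aeval (0 : σ → R) by
    simpa [aeval_eq_eval] using DFunLike.congr_fun this p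
  ext i
  simp [translate_X]

lemma pderiv_translate (a : σ → R) (j : σ) (p : MvPolynomial σ R) :
    pderiv j (translate a p) = translate a (pderiv j p) := by
  classical
  induction p using MvPolynomial.induction_on with
  | C r => simp only [← algebraMap_eq, AlgEquiv.commutes, Derivation.map_algebraMap, map_zero]
  | add p q hp hq => simp only [map_add, hp, hq]
  | mul_X p i hp =>
    simp only [map_mul, Derivation.leibniz, translate_X, map_sub, pderiv_C, smul_eq_mul, hp,
      map_add, pderiv_X, sub_zero]
    obtain rfl | h := eq_or_ne i j <;> simp [*]

lemma translate_mem_vanishingIdeal_pow_iff {a : σ → k} {p : MvPolynomial σ k} {m : ℕ} :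
    translate a p ∈ vanishingIdeal k {a} ^ m ↔ ∀ β, β.degree < m → coeff β p = 0 := by
  have hmem : ∀ {I : Ideal (MvPolynomial σ k)} {q}, translate a q ∈ I.map (translate a) ↔ q ∈ I :=
    Ideal.apply_mem_of_equiv_iff (f := (translate a).toRingEquiv)
  have hmap : vanishingIdeal k {a} = (idealOfVars σ k).map (translate a) := by
    ext q
    obtain ⟨q, rfl⟩ := (translate a).surjective q
    rw [hmem, mem_vanishingIdeal_singleton_iff, aeval_eq_eval, ← pow_one (idealOfVars σ k),
      mem_pow_idealOfVars_iff']
    simp [eval_translate, constantCoeff_eq, Finsupp.degree_eq_zero_iff]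
  rw [hmap, ← Ideal.map_pow, hmem, mem_pow_idealOfVars_iff']

lemma translate_monomial_mem_vanishingIdeal_pow {a : σ → k} {γ : σ →₀ ℕ} {m : ℕ}
    (h : m ≤ γ.degree) : translate a (monomial γ 1) ∈ vanishingIdeal k {a} ^ m := by
  classical
  rw [translate_mem_vanishingIdeal_pow_iff]
  rintro β hβ
  rw [coeff_monomial, if_neg]
  rintro rfl
  omega

end Translation

section IteratedDerivatives

variable {σ R : Type*} [CommSemiring R]

lemma coeff_pderiv_pow (j : σ) (b : ℕ) (γ : σ →₀ ℕ) (p : MvPolynomial σ R) :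
    coeff γ (((pderiv j).toLinearMap ^ b) p) =
      (γ j + 1).ascFactorial b * coeff (γ + Finsupp.single j b) p := by
  induction b generalizing γ with
  | zero => simp
  | succ b ih =>
    have hasc : (γ j + 1 + 1).ascFactorial b * (γ j + 1) = (γ j + 1).ascFactorial (b + 1) := by
      rw [Nat.ascFactorial_succ, ← Nat.succ_ascFactorial, mul_comm]
    rw [pow_succ', Module.End.mul_apply, Derivation.coeFn_coe, coeff_pderiv, ih, add_assoc,
      ← Finsupp.single_add, add_comm 1 b, Finsupp.add_apply, Finsupp.single_eq_same, mul_right_comm]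
    congr 1
    exact_mod_cast congrArg (Nat.cast (R := R)) hasc

lemma coeff_list_prod_pderiv_pow (β γ : σ →₀ ℕ) {l : List σ} (hl : l.Nodup)
    (p : MvPolynomial σ R) :
    coeff γ ((l.map fun j => (pderiv j).toLinearMap ^ β j).prod p) =
      (l.map fun j => ((γ j + 1).ascFactorial (β j) : R)).prod *
        coeff (γ + (l.map fun j => Finsupp.single j (β j)).sum) p := by
  induction l generalizing γ with
  | nil => simp
  | cons j l ih =>
    obtain ⟨hj, hl⟩ := List.nodup_cons.1 hl
    have hγ : ∀ i ∈ l, (γ + Finsupp.single j (β j)) i = γ i := fun i hi => by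
      simp [Finsupp.single_eq_of_ne (ne_of_mem_of_not_mem hi hj)]
    simp only [List.map_cons, List.prod_cons, List.sum_cons, Module.End.mul_apply,
      coeff_pderiv_pow, ih _ hl, mul_assoc, add_assoc]
    congr 2
    exact congrArg List.prod (List.map_congr_left fun i hi => by rw [hγ i hi])

variable {n : ℕ}

lemma coeff_iterPderiv (β γ : Fin n →₀ ℕ) (p : MvPolynomial (Fin n) ℂ) :
    coeff γ (iterPderiv β p) = (∏ i, ((γ i + 1).ascFactorial (β i) : ℂ)) * coeff (γ + β) p := by
  rw [iterPderiv, List.ofFn_eq_map, coeff_list_prod_pderiv_pow β γ (List.nodup_finRange n),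
    ← List.ofFn_eq_map, ← List.ofFn_eq_map, List.prod_ofFn, List.sum_ofFn, Finsupp.univ_sum_single]

lemma iterPderiv_translate (ξ : Fin n → ℂ) (β : Fin n →₀ ℕ) (p : MvPolynomial (Fin n) ℂ) :
    iterPderiv β (translate ξ p) = translate ξ (iterPderiv β p) := by
  suffices Commute (iterPderiv β) (translate ξ).toLinearMap from DFunLike.congr_fun this p
  refine Commute.list_prod_left _ _ fun D hD => ?_
  obtain ⟨j, rfl⟩ := List.mem_ofFn.1 hD
  exact Commute.pow_left (LinearMap.ext fun q => pderiv_translate ξ j q) _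

lemma eval_iterPderiv_translate (ξ : Fin n → ℂ) (β : Fin n →₀ ℕ) (p : MvPolynomial (Fin n) ℂ) :
    eval ξ (iterPderiv β (translate ξ p)) = (∏ i, ((β i).factorial : ℂ)) * coeff β p := by
  rw [iterPderiv_translate, eval_translate, constantCoeff_eq, coeff_iterPderiv, zero_add]
  simp [Nat.one_ascFactorial]

lemma diffEval_translate (ξ : Fin n → ℂ) (Λ p : MvPolynomial (Fin n) ℂ) :
    diffEval ξ Λ (translate ξ p) =
      ∑ β ∈ Λ.support, coeff β Λ * ((∏ i, ((β i).factorial : ℂ)) * coeff β p) := by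
  simp only [← eval_iterPderiv_translate ξ]
  rw [diffEval, Module.Basis.constr_apply, Finsupp.sum, LinearMap.sum_apply]
  rfl

lemma diffEval_translate_monomial (ξ : Fin n → ℂ) (Λ : MvPolynomial (Fin n) ℂ) (γ : Fin n →₀ ℕ) :
    diffEval ξ Λ (translate ξ (monomial γ 1)) = coeff γ Λ * ∏ i, ((γ i).factorial : ℂ) := by
  rw [diffEval_translate, Finset.sum_eq_single γ]
  · simp
  · intro β _ hβ
    simp [coeff_monomial, hβ.symm]
  · intro hγ
    simp [notMem_support_iff.1 hγ]

end IteratedDerivatives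

section InverseSystem

variable {K : Type*} [Field K] [Algebra K ℂ] {ι : Type*} {n t : ℕ} {ξ : Fin n → ℂ}
  {f : ι → MvPolynomial (Fin n) K}

lemma prod_factorial_ne_zero (γ : Fin n →₀ ℕ) : ∏ i, ((γ i).factorial : ℂ) ≠ 0 :=
  Finset.prod_ne_zero_iff.2 fun i _ => Nat.cast_ne_zero.2 (γ i).factorial_ne_zero

lemma totalDegree_le_iff_diffEval_eq_zero {Λ : MvPolynomial (Fin n) ℂ} :
    Λ.totalDegree ≤ t ↔ ∀ p ∈ vanishingIdeal ℂ {ξ} ^ (t + 1), diffEval ξ Λ p = 0 := by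
  constructor
  · intro hΛ p hp
    obtain ⟨p, rfl⟩ := (translate ξ).surjective p
    rw [translate_mem_vanishingIdeal_pow_iff] at hp
    rw [diffEval_translate]
    refine Finset.sum_eq_zero fun β hβ => ?_
    rw [hp β (Nat.lt_succ_of_le ((le_totalDegree hβ).trans hΛ)), mul_zero, mul_zero]
  · intro hΛ
    refine Finset.sup_le fun γ hγ => ?_
    by_contra! hlt
    have hcoeff := hΛ _ (translate_monomial_mem_vanishingIdeal_pow hlt)
    rw [diffEval_translate_monomial] at hcoeff
    exact mem_support_iff.1 hγ ((mul_eq_zero.1 hcoeff).resolve_right (prod_factorial_ne_zero γ))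

lemma exists_diffEval_eq {φ : Module.Dual ℂ (MvPolynomial (Fin n) ℂ)}
    (hφ : ∀ p ∈ vanishingIdeal ℂ {ξ} ^ t, φ p = 0) : ∃ Λ, diffEval ξ Λ = φ := by
  let Λ : MvPolynomial (Fin n) ℂ := ∑ γ ∈ (Finsupp.finite_of_degree_le t).toFinset,
    monomial γ (φ (translate ξ (monomial γ 1)) / ∏ i, ((γ i).factorial : ℂ))
  have hcoeff : ∀ γ, coeff γ Λ = φ (translate ξ (monomial γ 1)) / ∏ i, ((γ i).factorial : ℂ) := by
    intro γ
    simp only [Λ, coeff_sum, coeff_monomial, Finset.sum_ite_eq', Set.Finite.mem_toFinset,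
      Set.mem_ofPred_eq, ite_eq_left_iff, not_le]
    intro hγ
    rw [hφ _ (translate_monomial_mem_vanishingIdeal_pow hγ.le), zero_div]
  refine ⟨Λ, ((basisMonomials (Fin n) ℂ).map (translate ξ).toLinearEquiv).ext fun γ => ?_⟩
  simp only [Module.Basis.map_apply, coe_basisMonomials, AlgEquiv.toLinearEquiv_apply]
  rw [diffEval_translate_monomial, hcoeff, div_mul_cancel₀ _ (prod_factorial_ne_zero γ)]

lemma mem_inverseSystemLE {Λ : MvPolynomial (Fin n) ℂ} :
    Λ ∈ inverseSystemLE f ξ t ↔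
      ∀ p ∈ systemIdeal f ⊔ vanishingIdeal ℂ {ξ} ^ (t + 1), diffEval ξ Λ p = 0 := by
  rw [inverseSystemLE, Submodule.mem_inf, mem_restrictTotalDegree, inverseSystem,
    Submodule.mem_comap, Submodule.mem_dualAnnihilator,
    totalDegree_le_iff_diffEval_eq_zero (ξ := ξ)]
  refine ⟨fun ⟨hI, h𝔪⟩ p hp => ?_, fun h => ⟨fun p hp => h p (Ideal.mem_sup_left hp),
    fun p hp => h p (Ideal.mem_sup_right hp)⟩⟩
  obtain ⟨q, hq, r, hr, rfl⟩ := Submodule.mem_sup.1 hp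
  rw [map_add, hI q hq, h𝔪 r hr, add_zero]

lemma inverseSystemLE_succ_eq_iff :
    inverseSystemLE f ξ (t + 1) = inverseSystemLE f ξ t ↔
      vanishingIdeal ℂ {ξ} ^ (t + 1) ≤ systemIdeal f ⊔ vanishingIdeal ℂ {ξ} ^ (t + 2) := by
  constructor
  · intro h p hp
    by_contra hpW
    obtain ⟨φ, hφp, hφ⟩ := Submodule.exists_le_ker_of_notMem
      (p := (systemIdeal f ⊔ vanishingIdeal ℂ {ξ} ^ (t + 2)).restrictScalars ℂ) hpW
    obtain ⟨Λ, rfl⟩ := exists_diffEval_eq fun q hq => hφ (Ideal.mem_sup_right hq)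
    have hΛ : Λ ∈ inverseSystemLE f ξ (t + 1) := mem_inverseSystemLE.2 fun q hq => hφ hq
    rw [h] at hΛ
    exact hφp (mem_inverseSystemLE.1 hΛ p (Ideal.mem_sup_right hp))
  · intro h
    have hsup : systemIdeal f ⊔ vanishingIdeal ℂ {ξ} ^ (t + 1) =
        systemIdeal f ⊔ vanishingIdeal ℂ {ξ} ^ (t + 2) :=
      le_antisymm (sup_le le_sup_left h)
        (sup_le_sup_left (Ideal.pow_le_pow_right (t + 1).le_succ) _)
    ext Λ
    rw [mem_inverseSystemLE, mem_inverseSystemLE, hsup]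

lemma IsIsolatedRoot.inverseSystemLE_succ_eq_iff (hf : IsIsolatedRoot f ξ) :
    inverseSystemLE f ξ (t + 1) = inverseSystemLE f ξ t ↔
      vanishingIdeal ℂ {ξ} ^ (t + 1) ≤ primaryComponent (systemIdeal f) ξ := by
  rw [Deflation.inverseSystemLE_succ_eq_iff]
  refine ⟨fun h => ?_, fun h => h.trans (primaryComponent_le_sup_pow _ _ _)⟩
  obtain ⟨M, hM⟩ := hf.exists_pow_le
  refine le_of_le_sup_mul_of_pow_le hM (h.trans ?_)
  rw [← pow_succ']
  exact sup_le_sup_right (le_primaryComponent _ _) _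

lemma IsIsolatedRoot.nilIndex_le_iff (hf : IsIsolatedRoot f ξ) :
    nilIndex f ξ ≤ t ↔ vanishingIdeal ℂ {ξ} ^ (t + 1) ≤ primaryComponent (systemIdeal f) ξ := by
  rw [← hf.inverseSystemLE_succ_eq_iff]
  refine ⟨fun h => ?_, fun h => Nat.sInf_le h⟩
  obtain ⟨M, hM⟩ := hf.exists_pow_le
  have hmem : nilIndex f ξ ∈ {t | inverseSystemLE f ξ (t + 1) = inverseSystemLE f ξ t} :=
    Nat.sInf_mem ⟨M, hf.inverseSystemLE_succ_eq_iff.2 <|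
      (Ideal.pow_le_pow_right M.le_succ).trans hM⟩
  have hpow := hf.inverseSystemLE_succ_eq_iff.1 hmem
  exact hf.inverseSystemLE_succ_eq_iff.2 <|
    (Ideal.pow_le_pow_right (Nat.succ_le_succ h)).trans hpow

end InverseSystem

section DeflationByDerivation

variable {K : Type*} [Field K] [Algebra K ℂ] {ι κ : Type*} {n : ℕ} {ξ : Fin n → ℂ}
  {f : ι → MvPolynomial (Fin n) K} {g : κ → MvPolynomial (Fin n) K}
  {D : Derivation ℂ (MvPolynomial (Fin n) ℂ) (MvPolynomial (Fin n) ℂ)}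
  {l : MvPolynomial (Fin n) ℂ}

lemma IsIsolatedRoot.nilIndex_lt_of_derivation (hf : IsIsolatedRoot f ξ) (hg : IsRoot g ξ)
    (hfg : systemIdeal f ≤ systemIdeal g) (hD : ∀ p ∈ systemIdeal f, D p ∈ systemIdeal g)
    (hl : eval ξ (D l) ≠ 0) : nilIndex g ξ < nilIndex f ξ := by
  have hDl : D (l - C (eval ξ l)) = D l := by
    rw [map_sub, ← algebraMap_eq, D.map_algebraMap, sub_zero]
  have hpow : vanishingIdeal ℂ {ξ} ^ nilIndex f ξ ≤ primaryComponent (systemIdeal g) ξ := by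
    refine pow_le_of_derivation (D := D) (l := l - C (eval ξ l)) (primaryComponent_mono hfg)
      (fun p => derivation_mem_primaryComponent D hfg hD)
      (fun p => mem_primaryComponent_of_mul_mem (hDl.symm ▸ hl)) ?_ (hf.nilIndex_le_iff.1 le_rfl)
    simp [aeval_eq_eval]
  cases hnil : nilIndex f ξ with
  | zero =>
    rw [hnil, pow_zero, Ideal.one_eq_top, top_le_iff] at hpow
    exact absurd hpow (primaryComponent_ne_top (systemIdeal_le_vanishingIdeal_iff.2 hg))
  | succ t =>
    rw [hnil] at hpow
    exact Nat.lt_succ_of_le ((hf.of_systemIdeal_le hg hfg).nilIndex_le_iff.2 hpow)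

lemma IsIsolatedRoot.multiplicity_lt_of_nilIndex_lt (hf : IsIsolatedRoot f ξ) (hg : IsRoot g ξ)
    (hfg : systemIdeal f ≤ systemIdeal g) (hlt : nilIndex g ξ < nilIndex f ξ) :
    multiplicity g ξ < multiplicity f ξ := by
  have := hf.finite_quotient
  refine finrank_quotient_lt ((primaryComponent_mono hfg).lt_of_ne fun hQ => hlt.not_ge ?_)
  rw [hf.nilIndex_le_iff, hQ, ← (hf.of_systemIdeal_le hg hfg).nilIndex_le_iff]

end DeflationByDerivation

section KernelMatrix

open Matrix

lemma det_ne_zero_of_rank_eq_card {m F : Type*} [Fintype m] [DecidableEq m] [Field F]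
    {A : Matrix m m F} (h : A.rank = Fintype.card m) : A.det ≠ 0 := by
  rw [← isUnit_iff_ne_zero, ← isUnit_iff_isUnit_det, ← mulVec_surjective_iff_isUnit]
  have hrange : LinearMap.range A.mulVecLin = ⊤ :=
    Submodule.eq_top_of_finrank_eq (h.trans (Module.finrank_fintype_fun_eq_card F).symm)
  exact LinearMap.range_eq_top.1 hrange

lemma mulVec_eq_zero_of_rank_le_submatrix {l m n F : Type*} [Fintype n] [Field F]
    {M : Matrix m n F} {e : l → m} (h : M.rank ≤ (M.submatrix e id).rank) {v : n → F}
    (hv : M.submatrix e id *ᵥ v = 0) : M *ᵥ v = 0 := by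
  have hle : LinearMap.ker M.mulVecLin ≤ LinearMap.ker (M.submatrix e id).mulVecLin :=
    fun w hw => _root_.funext fun i => congrFun hw (e i)
  have hM := LinearMap.finrank_range_add_finrank_ker M.mulVecLin
  have hMe := LinearMap.finrank_range_add_finrank_ker (M.submatrix e id).mulVecLin
  have heq := Submodule.eq_of_le_of_finrank_le hle (by rw [Matrix.rank, Matrix.rank] at h; omega)
  exact heq.ge hv

variable {K : Type*} [Field K] {ι : Type*} {n r s c : ℕ} {f : ι → MvPolynomial (Fin n) K}
  {rows : Fin r ⊕ Fin s ≃ ι} {cols : Fin r ⊕ Fin c ≃ Fin n}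

lemma formalDifferential_rows_inl (i : Fin c) (a : Fin r) :
    formalDifferential f rows cols i (f (rows (Sum.inl a))) = 0 := by
  have hmul :
      fromCols (blockA f rows cols) (blockB f rows cols) * kernelMatrix f rows cols = 0 := by
    rw [kernelMatrix, fromCols_mul_fromRows, Matrix.mul_neg, ← Matrix.mul_assoc, mul_adjugate,
      Matrix.mul_smul, Matrix.mul_one, Matrix.smul_mul, Matrix.one_mul, neg_add_cancel]
  rw [formalDifferential, ← Equiv.sum_comp cols]
  refine (Fintype.sum_congr _ _ fun j => ?_).trans (congrFun (congrFun hmul a) i)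
  obtain j | j := j <;> simp [blockA, blockB, jacobian, mul_comm, toBlocks₁₁, toBlocks₁₂]

variable [Algebra K ℂ] {ξ : Fin n → ℂ}

lemma aeval_formalDifferential_eq_zero (hr : (evalMatrix ξ (jacobian f)).rank = r)
    (hA : (evalMatrix ξ (blockA f rows cols)).rank = r) (i : Fin c) (k : ι) :
    aeval ξ (formalDifferential f rows cols i (f k)) = 0 := by
  have hmulVec : ∀ k, (evalMatrix ξ (jacobian f) *ᵥ
      fun j => aeval ξ (kernelMatrix f rows cols (cols.symm j) i)) k =
        aeval ξ (formalDifferential f rows cols i (f k)) := fun k => by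
    simp [mulVec, dotProduct, evalMatrix, jacobian, formalDifferential, mul_comm]
  have hrank : (evalMatrix ξ (jacobian f)).rank ≤
      ((evalMatrix ξ (jacobian f)).submatrix (rows ∘ Sum.inl) id).rank :=
    calc (evalMatrix ξ (jacobian f)).rank
      _ = (evalMatrix ξ (blockA f rows cols)).rank := hr.trans hA.symm
      _ = (((evalMatrix ξ (jacobian f)).submatrix (rows ∘ Sum.inl) id).submatrix id
            (cols ∘ Sum.inl)).rank := rfl
      _ ≤ _ := rank_submatrix_le _ id (cols ∘ Sum.inl)
  rw [← hmulVec, mulVec_eq_zero_of_rank_le_submatrix hrank, Pi.zero_apply]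
  refine _root_.funext fun a => (hmulVec (rows (Sum.inl a))).trans ?_
  rw [formalDifferential_rows_inl, map_zero, Pi.zero_apply]

lemma IsRoot.deflatedSystem (hf : IsRoot f ξ) (hr : (evalMatrix ξ (jacobian f)).rank = r)
    (hA : (evalMatrix ξ (blockA f rows cols)).rank = r) (S : Finset (Fin c)) :
    IsRoot (deflatedSystem f rows cols S) ξ := by
  rintro (k | q)
  · exact hf k
  · exact aeval_formalDifferential_eq_zero hr hA _ _

variable (f rows cols) in
/-- The operator `Λ_i`, which `formalDifferential` defines on polynomials over `K`, as a derivation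
of `ℂ[x₁, …, xₙ]`. -/
noncomputable def formalDerivation (i : Fin c) :
    Derivation ℂ (MvPolynomial (Fin n) ℂ) (MvPolynomial (Fin n) ℂ) :=
  ∑ j, map (algebraMap K ℂ) (kernelMatrix f rows cols (cols.symm j) i) • pderiv j

lemma formalDerivation_apply (i : Fin c) (p : MvPolynomial (Fin n) ℂ) :
    formalDerivation f rows cols i p =
      ∑ j, map (algebraMap K ℂ) (kernelMatrix f rows cols (cols.symm j) i) * pderiv j p := by
  rw [formalDerivation, ← Derivation.coeFnAddMonoidHom_apply, map_sum, Finset.sum_apply]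
  rfl

lemma formalDerivation_map (i : Fin c) (p : MvPolynomial (Fin n) K) :
    formalDerivation f rows cols i (map (algebraMap K ℂ) p) =
      map (algebraMap K ℂ) (formalDifferential f rows cols i p) := by
  simp [formalDerivation_apply, formalDifferential, pderiv_map]

lemma eval_formalDerivation_X_ne_zero (hA : (evalMatrix ξ (blockA f rows cols)).rank = r)
    (i : Fin c) : eval ξ (formalDerivation f rows cols i (X (cols (Sum.inr i)))) ≠ 0 := by
  have hdet := det_ne_zero_of_rank_eq_card (hA.trans (Fintype.card_fin r).symm)
  rw [evalMatrix, ← AlgHom.mapMatrix_apply, ← AlgHom.map_det] at hdet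
  simpa [formalDerivation_apply, pderiv_X, Pi.single_apply, kernelMatrix, eval_map, ← aeval_def]
    using hdet

lemma systemIdeal_le_deflatedSystem (f : ι → MvPolynomial (Fin n) K) (rows : Fin r ⊕ Fin s ≃ ι)
    (cols : Fin r ⊕ Fin c ≃ Fin n) (S : Finset (Fin c)) :
    systemIdeal f ≤ systemIdeal (deflatedSystem f rows cols S) :=
  Ideal.span_mono (Set.range_subset_iff.2 fun k => ⟨Sum.inl k, rfl⟩)

lemma formalDerivation_mem_systemIdeal_deflatedSystem {S : Finset (Fin c)} {i : Fin c} (hi : i ∈ S)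
    {p : MvPolynomial (Fin n) ℂ} (hp : p ∈ systemIdeal f) :
    formalDerivation f rows cols i p ∈ systemIdeal (deflatedSystem f rows cols S) := by
  refine derivation_mem_of_span _ (systemIdeal_le_deflatedSystem f rows cols S) ?_ hp
  rintro _ ⟨k, rfl⟩
  rw [formalDerivation_map]
  exact Ideal.subset_span ⟨Sum.inr (⟨i, hi⟩, k), rfl⟩

end KernelMatrix

end Deflation

theorem mainTheorem4 (K : Subfield ℂ) (n N r s c : ℕ)
    (f : Fin N → MvPolynomial (Fin n) K) (ξ : Fin n → ℂ)
    (hξ : Deflation.IsIsolatedRoot f ξ)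
    (hr : (Deflation.evalMatrix ξ (Deflation.jacobian f)).rank = r) (hrn : r < n)
    (rows : Fin r ⊕ Fin s ≃ Fin N) (cols : Fin r ⊕ Fin c ≃ Fin n)
    (hA : (Deflation.evalMatrix ξ (Deflation.blockA f rows cols)).rank = r)
    (S : Finset (Fin c)) (hS : S.Nonempty) :
    Deflation.IsIsolatedRoot (Deflation.deflatedSystem f rows cols S) ξ ∧
      1 ≤ Deflation.multiplicity (Deflation.deflatedSystem f rows cols S) ξ ∧
      Deflation.nilIndex (Deflation.deflatedSystem f rows cols S) ξ < Deflation.nilIndex f ξ ∧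
      Deflation.multiplicity (Deflation.deflatedSystem f rows cols S) ξ <
        Deflation.multiplicity f ξ := by
  obtain ⟨i, hi⟩ := hS
  have hroot := hξ.1.deflatedSystem hr hA S
  have hle := Deflation.systemIdeal_le_deflatedSystem f rows cols S
  have hisolated := hξ.of_systemIdeal_le hroot hle
  have hnil := hξ.nilIndex_lt_of_derivation hroot hle
    (fun _ => Deflation.formalDerivation_mem_systemIdeal_deflatedSystem hi)
    (Deflation.eval_formalDerivation_X_ne_zero hA i)
  exact ⟨hisolated, hisolated.one_le_multiplicity, hnil,
    hξ.multiplicity_lt_of_nilIndex_lt hroot hle hnil⟩
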